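/- Let $n\ge 1$ and $m,\ell\ge 0$ be integers, let $b:\mathbb{R}^\ell\to\mathbb{R}$ be convex, and let $$P(x,\lambda)=P_0(x)+\lambda_1P_1(x)+\cdots+\lambda_\ell P_\ell(x),\qquad x\in\mathbb{R}^n,\ \lambda\in\mathbb{R}^\ell,$$ be an $m\times m$ symmetric matrix that is polynomial in $x$ and affine in $\lambda$. Let $\mathcal{G}$ be a chordal graph with vertices $\{1,\ldots,m\}$ (every cycle of length at least $4$ has a chord), with edge set $\mathcal{E}$ and maximal cliques $\mathcal{C}_1,\ldots,\mathcal{C}_t$, that describes the sparsity of $P$: for all $\lambda$, $P_{ij}(\cdot,\lambda)\equiv 0$ whenever $i\neq j$ and $(i,j)\notin\mathcal{E}$. Let $E_{\mathcal{C}_k}$ be the $|\mathcal{C}_k|\times m$ zero-one matrix such that $E_{\mathcal{C}_k}^{\mathsf T}SE_{\mathcal{C}_k}$ is the $m\times m$ matrix whose principal submatrix indexed by $\mathcal{C}_k$ is $S$ and whose other entries vanish. A polynomial matrix $S(x)$ is SOS if $S(x)=H(x)^{\mathsf T}H(x)$ for some (possibly rectangular) polynomial matrix $H(x)$; let $\Sigma^{r}_{d}$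 be the set of $r\times r$ SOS matrices of degree at most $d$. Let $\deg(P)$ be the degree of $P$ in $x$ and, for $\nu\in\mathbb{N}$, let $d_\nu$ be the smallest even integer no smaller than $2\nu+\deg(P)$. Let $$B^*=\inf\bigl\{b(\lambda):\ \lambda\in\mathbb{R}^\ell,\ P(x,\lambda)\succeq 0\ \text{ for all } x\in\mathbb{R}^n\bigr\}$$ and let $B^*_\nu$ be the infimum of $b(\lambda)$ over all $\lambda\in\mathbb{R}^\ell$ and all $S_1\in\Sigma^{|\mathcal{C}_1|}_{d_\nu},\ldots,S_t\in\Sigma^{|\mathcal{C}_t|}_{d_\nu}$ such that $$(x_1^2+\cdots+x_n^2)^\nu P(x,\lambda)=\sum_{k=1}^{t}E_{\mathcal{C}_k}^{\mathsf T}S_k(x)E_{\mathcal{C}_k}.$$ Both infima are taken in $[-\infty,+\infty]$, with $\inf\emptyset=+\infty$. Suppose that, for every $\lambda$, $P(x,\lambda)$ is homogeneous in $x$ and even in $x$ (it contains only monomials in which every $x_i$ has an even exponent), and that there exists $\lambda_0$ such that $P(x,\lambda_0)$ is positive definite for all $x\in\mathbb{R}^n\setminus\{0\}$. Then $B^*_\nu\to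 B^*$ from above as $\nu\to\infty$; that is, $B^*\le B^*_\nu$ for every $\nu\in\mathbb{N}$, and $\lim_{\nu\to\infty}B^*_\nu=B^*$. -/

import Mathlib

open MvPolynomial

namespace SparseSOS

/-- An undirected graph is chordal if every cycle of length at least four has a chord: an edge of
the graph joining two vertices of the cycle that are not consecutive along the cycle. -/
def IsChordal {V : Type*} (G : SimpleGraph V) : Prop :=
  ∀ (v : V) (c : G.Walk v v), c.IsCycle → 4 ≤ c.length →
    ∃ u ∈ c.support, ∃ w ∈ c.support, G.Adj u w ∧ s(u, w) ∉ c.edges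

open Classical in
/-- The maximal cliques of a graph on `{1, …, m}`: cliques not contained in any other clique. -/
noncomputable def maximalCliques {m : ℕ} (G : SimpleGraph (Fin m)) : Finset (Finset (Fin m)) :=
  Finset.univ.filter fun C => Maximal (fun s : Finset (Fin m) => G.IsClique (s : Set (Fin m))) C

/-- A polynomial matrix in `n` real variables. -/
abbrev PolyMatrix (n : ℕ) (ι κ : Type*) := Matrix ι κ (MvPolynomial (Fin n) ℝ)

/-- The value `P(x)` of a polynomial matrix at a point `x ∈ ℝⁿ`. -/
noncomputable def PolyMatrix.evalAt {n : ℕ} {ι κ : Type*} (P : PolyMatrix n ι κ)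
    (x : Fin n → ℝ) : Matrix ι κ ℝ :=
  P.map (MvPolynomial.eval x)

/-- All entries are homogeneous of one common degree. -/
def PolyMatrix.IsHomogeneous {n : ℕ} {ι κ : Type*} (P : PolyMatrix n ι κ) : Prop :=
  ∃ d : ℕ, ∀ i j, (P i j).IsHomogeneous d

/-- Only monomials in which every variable has an even exponent occur. -/
def PolyMatrix.IsEven {n : ℕ} {ι κ : Type*} (P : PolyMatrix n ι κ) : Prop :=
  ∀ i j, ∀ α ∈ (P i j).support, ∀ k, Even (α k)

/-- The degree of a polynomial matrix: the largest total degree of an entry. -/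
noncomputable def PolyMatrix.degree {n : ℕ} {ι κ : Type*} [Fintype ι] [Fintype κ]
    (P : PolyMatrix n ι κ) : ℕ :=
  Finset.univ.sup fun i => Finset.univ.sup fun j => (P i j).totalDegree

/-- `S(x)` is SOS if `S(x) = H(x)ᵀ H(x)` for a polynomial matrix `H(x)` with any number of rows. -/
def PolyMatrix.IsSOS {n : ℕ} {ι : Type*} (S : PolyMatrix n ι ι) : Prop :=
  ∃ (r : ℕ) (H : PolyMatrix n (Fin r) ι), S = H.transpose * H

/-- The set of SOS matrices with index set `ι` and of degree `d` or less. -/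
def sosCone (n : ℕ) (ι : Type*) [Fintype ι] (d : ℕ) : Set (PolyMatrix n ι ι) :=
  {S | S.IsSOS ∧ S.degree ≤ d}

/-- The `|C| × m` matrix `E_C`, with the rows indexed by the elements of `C` themselves. -/
noncomputable def inflation (n : ℕ) {m : ℕ} (C : Finset (Fin m)) : PolyMatrix n C (Fin m) :=
  Matrix.of fun i j => if (i : Fin m) = j then 1 else 0

/-- The data of an `m × m` polynomial matrix
`P(x, lam) = P₀(x) + lam₁ P₁(x) + ⋯ + lam_ℓ P_ℓ(x)`, affine in `lam ∈ ℝ^ℓ`. -/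
structure AffinePolyMatrix (n m ℓ : ℕ) where
  /-- the matrix `P₀(x)` -/
  const : PolyMatrix n (Fin m) (Fin m)
  /-- the matrices `P₁(x), …, P_ℓ(x)` -/
  coeff : Fin ℓ → PolyMatrix n (Fin m) (Fin m)

/-- The polynomial matrix `P(·, lam)`. -/
noncomputable def AffinePolyMatrix.at {n m ℓ : ℕ} (P : AffinePolyMatrix n m ℓ)
    (lam : Fin ℓ → ℝ) : PolyMatrix n (Fin m) (Fin m) :=
  P.const + ∑ k, lam k • P.coeff k

/-- The degree of `P(x, lam)` as a polynomial in `x`, with coefficients depending on `lam`. -/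
noncomputable def AffinePolyMatrix.degree {n m ℓ : ℕ} (P : AffinePolyMatrix n m ℓ) : ℕ :=
  max P.const.degree (Finset.univ.sup fun k => (P.coeff k).degree)

/-- `B* = inf { b(lam) : P(x, lam) ⪰ 0 for all x ∈ ℝⁿ }`, in the extended reals. -/
noncomputable def optimalValue {n m ℓ : ℕ} (P : AffinePolyMatrix n m ℓ)
    (b : (Fin ℓ → ℝ) → ℝ) : EReal :=
  ⨅ (lam : Fin ℓ → ℝ) (_ : ∀ x : Fin n → ℝ, ((P.at lam).evalAt x).PosSemidef), (b lam : EReal)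

/-- `d_ν`: the smallest even integer no smaller than `2ν + deg P`. -/
noncomputable def degreeBound {n m ℓ : ℕ} (P : AffinePolyMatrix n m ℓ) (ν : ℕ) : ℕ :=
  sInf {d : ℕ | Even d ∧ 2 * ν + P.degree ≤ d}

/-- Feasibility of `lam` and the matrices `S_C`, for `C` a maximal clique of `G`, in the sparse SOS
problem with weight `(x₁² + ⋯ + x_n²)^ν`. Values of `S` at other sets `C` play no role. -/
def IsSparseFeasible {n m ℓ : ℕ} (G : SimpleGraph (Fin m)) (P : AffinePolyMatrix n m ℓ) (ν : ℕ)
    (lam : Fin ℓ → ℝ) (S : (C : Finset (Fin m)) → PolyMatrix n C C) : Prop :=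
  ((∑ i : Fin n, (X i : MvPolynomial (Fin n) ℝ) ^ 2) ^ ν) • P.at lam =
      ∑ C ∈ maximalCliques G, (inflation n C).transpose * S C * inflation n C ∧
    ∀ C ∈ maximalCliques G, S C ∈ sosCone n C (degreeBound P ν)

/-- `B_ν*`: the optimal value of the sparse SOS problem with weight `(x₁² + ⋯ + x_n²)^ν`, in the
extended reals. -/
noncomputable def sparseOptimalValue {n m ℓ : ℕ} (G : SimpleGraph (Fin m))
    (P : AffinePolyMatrix n m ℓ) (b : (Fin ℓ → ℝ) → ℝ) (ν : ℕ) : EReal :=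
  ⨅ (lam : Fin ℓ → ℝ) (S : (C : Finset (Fin m)) → PolyMatrix n C C)
    (_ : IsSparseFeasible G P ν lam S), (b lam : EReal)

end SparseSOS

/-! Feasible certificates force `P(x, λ) ⪰ 0`, since the weight is positive off the origin and
homogeneity settles the origin; hence `B* ≤ B*_ν`. For convergence, take a feasible `λ` with `b(λ)`
close to `B*` and move it slightly towards `λ₀`. Convexity of `b` controls the cost, and the new
matrix `M` is positive definite off the origin. It remains to certify this one `M` for all large
`ν`; no monotonicity in `ν` is needed.

Evenness gives `M(x) = Q(x₁², …, x_n²)` with `Q` homogeneous and positive definite on the simplex.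
By the matrix form of Pólya's theorem (`polya_matrix`), for large `ν` every coefficient matrix of
`(∑ yᵢ)^ν Q(y)` in the top degree is positive definite. So `(∑ xᵢ²)^ν M` is a sum of terms `x^(2β)
A_β` with `A_β` positive definite and of pattern `G`. Such constant matrices split into rank-one
pieces `w wᵀ` supported on cliques (`IsChordal.mem_closure_vecMulVec`), by Cholesky elimination
along simplicial vertices, which Dirac's theorem supplies. Each `x^(2β) w wᵀ` is SOS on a maximal
clique. -/

namespace SparseSOS

/-! ### Simplicial vertices of chordal graphs -/

section Chordal

variable {V : Type*}

/-- The graph on the same vertices whose edges are the edges of `G` with both ends in `W`. -/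
def restrictTo (G : SimpleGraph V) (W : Set V) : SimpleGraph V where
  Adj x y := x ∈ W ∧ y ∈ W ∧ G.Adj x y
  symm := ⟨fun _ _ h => ⟨h.2.1, h.1, h.2.2.symm⟩⟩
  loopless := ⟨fun _ h => h.2.2.ne rfl⟩

theorem restrictTo_mono (G : SimpleGraph V) {W W' : Set V} (h : W ⊆ W') :
    restrictTo G W ≤ restrictTo G W' :=
  fun _ _ hxy => ⟨h hxy.1, h hxy.2.1, hxy.2.2⟩

theorem restrictTo_le (G : SimpleGraph V) (W : Set V) : restrictTo G W ≤ G :=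
  fun _ _ hxy => hxy.2.2

theorem mem_of_mem_support_restrictTo {G : SimpleGraph V} {W : Set V} {s t x : V} (hs : s ∈ W)
    (p : (restrictTo G W).Walk s t) (hx : x ∈ p.support) : x ∈ W := by
  induction p with
  | nil => simp at hx; exact hx ▸ hs
  | cons h p ih =>
    rw [SimpleGraph.Walk.support_cons, List.mem_cons] at hx
    rcases hx with rfl | hx
    · exact hs
    · exact ih h.2.1 hx

/-- A shortest walk has no chords. -/
theorem mem_edges_of_adj_of_length_eq_dist {H : SimpleGraph V} {s t u w : V} (p : H.Walk s t)
    (hp : p.length = H.dist s t) (hu : u ∈ p.support) (hw : w ∈ p.support) (h : H.Adj u w) :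
    s(u, w) ∈ p.edges := by
  obtain ⟨i, rfl, hi⟩ := SimpleGraph.Walk.mem_support_iff_exists_getVert.mp hu
  obtain ⟨j, rfl, hj⟩ := SimpleGraph.Walk.mem_support_iff_exists_getVert.mp hw
  have key : ∀ i j, i ≤ p.length → j ≤ p.length → i < j → H.Adj (p.getVert i) (p.getVert j) →
      s(p.getVert i, p.getVert j) ∈ p.edges := by
    intro i j hi hj hij h
    -- The shortcut through the edge has length `i + 1 + (p.length - j)`, so minimality of `p`
    -- forces `j = i + 1`.
    have hd := SimpleGraph.dist_le ((p.take i).append (SimpleGraph.Walk.cons h (p.drop j)))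
    simp only [SimpleGraph.Walk.length_append, SimpleGraph.Walk.length_cons,
      SimpleGraph.Walk.take_length, SimpleGraph.Walk.drop_length] at hd
    obtain rfl : j = i + 1 := by omega
    exact (SimpleGraph.Walk.mk_mem_edges_iff_exists _).mpr ⟨i, by omega, rfl⟩
  rcases lt_trichotomy i j with hij | rfl | hij
  · exact key i j hi hj hij h
  · exact absurd rfl h.ne
  · rw [Sym2.eq_swap]
    exact key j i hj hi hij h.symm

/-- In a chordal graph, two neighbours of `a` joined by a path that avoids the other neighbours
of `a` are adjacent. -/
theorem IsChordal.adj_of_reachable {G : SimpleGraph V} (hG : IsChordal G) {a s t : V} {W : Set V}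
    (haW : a ∉ W) (hW : ∀ x ∈ W, ¬ G.Adj a x) (has : G.Adj a s) (hat : G.Adj a t) (hst : s ≠ t)
    (hr : (restrictTo G (W ∪ {s, t})).Reachable s t) : G.Adj s t := by
  by_contra hnadj
  obtain ⟨p, hpath, hlen⟩ := hr.exists_path_of_dist
  have hsup : ∀ x ∈ p.support, x ∈ W ∪ {s, t} := fun x hx =>
    mem_of_mem_support_restrictTo (by simp) p hx
  have ha : a ∉ p.support := fun h => by
    rcases hsup a h with h | rfl | rfl
    · exact haW h
    · exact has.ne rfl
    · exact hat.ne rfl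
  have hnb : ∀ x ∈ p.support, G.Adj a x → x = s ∨ x = t := fun x hx hax => by
    rcases hsup x hx with h | h
    · exact absurd hax (hW x h)
    · simpa using h
  have h2 : 2 ≤ p.length := by
    rcases Nat.lt_or_ge p.length 2 with h | h
    · have h01 : p.length = 0 ∨ p.length = 1 := by omega
      rcases h01 with h0 | h1
      · exact absurd (SimpleGraph.Walk.eq_of_length_eq_zero h0) hst
      · exact absurd (SimpleGraph.Walk.adj_of_length_eq_one h1).2.2 hnadj
    · exact h
  set q := p.mapLe (restrictTo_le G _) with hq
  have hqs : q.support = p.support := by simp [hq]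
  have hqe : q.edges = p.edges := by simp [hq]
  have hqpath : q.IsPath := (SimpleGraph.Walk.isPath_mapLe _).mpr hpath
  -- Closing the shortest path through `a` gives a cycle of length at least 4. It has no chord: on
  -- the path, `a` is adjacent only to `s` and `t`, and a shortest path has no chord of its own.
  have hcyc : (SimpleGraph.Walk.cons has (q.concat hat.symm)).IsCycle := by
    rw [SimpleGraph.Walk.cons_isCycle_iff]
    refine ⟨hqpath.concat (by rwa [hqs]) hat.symm, ?_⟩
    rw [SimpleGraph.Walk.edges_concat, hqe]
    simp only [List.concat_eq_append, List.mem_append, List.mem_singleton, not_or]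
    refine ⟨fun h => ha (SimpleGraph.Walk.fst_mem_support_of_mem_edges p h), ?_⟩
    simp only [Sym2.eq_iff]
    rintro (⟨rfl, -⟩ | ⟨-, rfl⟩)
    · exact hat.ne rfl
    · exact hst rfl
  obtain ⟨u, hu, w, hw, huw, he⟩ := hG a _ hcyc (by simp [hq]; omega)
  simp only [SimpleGraph.Walk.support_cons, SimpleGraph.Walk.support_concat, hqs,
    SimpleGraph.Walk.edges_cons, SimpleGraph.Walk.edges_concat, hqe, List.concat_eq_append,
    List.mem_cons, List.mem_append, List.not_mem_nil, or_false, not_or] at hu hw he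
  have hu' : u = a ∨ u ∈ p.support := by tauto
  have hw' : w = a ∨ w ∈ p.support := by tauto
  rcases hu' with rfl | hu'
  · rcases hw' with rfl | hw'
    · exact huw.ne rfl
    · rcases hnb w hw' huw with rfl | rfl
      · exact he.1 rfl
      · exact he.2.2 Sym2.eq_swap
  · rcases hw' with rfl | hw'
    · rcases hnb u hu' huw.symm with rfl | rfl
      · exact he.1 Sym2.eq_swap
      · exact he.2.2 rfl
    · exact he.2.1 (mem_edges_of_adj_of_length_eq_dist p hlen hu' hw'
        ⟨hsup u hu', hsup w hw', huw⟩)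

/-- Outside every clique that is not the whole vertex set, a chordal graph has a vertex whose
neighbours form a clique. The statement is about the subgraph induced on `U`. -/
theorem IsChordal.exists_simplicial_notMem_clique {G : SimpleGraph V} (hG : IsChordal G)
    (U K : Finset V) (hKU : K ⊂ U) (hK : G.IsClique (K : Set V)) :
    ∃ v ∈ U, v ∉ K ∧ G.IsClique {w | w ∈ U ∧ G.Adj v w} := by
  classical
  induction U using Finset.strongInduction generalizing K with
  | H U ih =>
  by_cases hU : G.IsClique (U : Set V)
  · obtain ⟨v, hv, hvK⟩ := Finset.exists_of_ssubset hKU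
    exact ⟨v, hv, hvK, SimpleGraph.IsClique.subset (fun w hw => hw.1) hU⟩
  -- The vertex `a` is chosen so that none of its non-neighbours lies in `K`: either `a ∈ K`, or the
  -- vertices of `K` are adjacent to everything in `U`. The vertex found below will be such a
  -- non-neighbour.
  obtain ⟨a, haU, ⟨c, hcU, hca, hac⟩, haK⟩ : ∃ a ∈ U, (∃ c ∈ U, c ≠ a ∧ ¬ G.Adj a c) ∧
      (a ∈ K ∨ ∀ k ∈ K, ∀ c ∈ U, c ≠ k → G.Adj k c) := by
    by_cases h : ∃ a ∈ K, ∃ c ∈ U, c ≠ a ∧ ¬ G.Adj a c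
    · obtain ⟨a, ha, h⟩ := h
      exact ⟨a, hKU.1 ha, h, Or.inl ha⟩
    · push Not at h
      rw [SimpleGraph.isClique_iff, Set.Pairwise] at hU
      push Not at hU
      obtain ⟨a, ha, c, hc, hac, hadj⟩ := hU
      exact ⟨a, ha, ⟨c, hc, hac.symm, hadj⟩, Or.inr h⟩
  -- `B` is the component of `c` among the non-neighbours of `a`, and `S` its boundary in `U`. All
  -- of `S` is adjacent to `a`, and paths through `B` join its members, so `S` is a clique.
  set W : Set V := {x | x ∈ U ∧ x ≠ a ∧ ¬ G.Adj a x} with hW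
  set B : Finset V := U.filter fun x => x ∈ W ∧ (restrictTo G W).Reachable c x with hB
  set S : Finset V := U.filter fun x => x ∉ B ∧ ∃ y ∈ B, G.Adj x y with hS
  have hcB : c ∈ B := by simp [hB, hW, hcU, hca, hac]
  have hSa : ∀ x ∈ S, G.Adj a x := by
    intro x hx
    simp only [hS, Finset.mem_filter] at hx
    obtain ⟨hxU, hxB, y, hy, hxy⟩ := hx
    simp only [hB, Finset.mem_filter] at hy
    by_contra hax
    have hxa : x ≠ a := by
      rintro rfl
      exact hy.2.1.2.2 hxy
    have hxW : x ∈ W := ⟨hxU, hxa, hax⟩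
    refine hxB (Finset.mem_filter.mpr ⟨hxU, hxW, hy.2.2.trans ?_⟩)
    exact SimpleGraph.Adj.reachable ⟨hy.2.1, hxW, hxy.symm⟩
  have hSclique : G.IsClique (S : Set V) := by
    intro s hs t ht hst
    have hs' := (Finset.mem_filter.mp hs).2
    have ht' := (Finset.mem_filter.mp ht).2
    obtain ⟨-, y, hy, hsy⟩ := hs'
    obtain ⟨-, z, hz, htz⟩ := ht'
    have hy' := (Finset.mem_filter.mp hy).2
    have hz' := (Finset.mem_filter.mp hz).2
    refine hG.adj_of_reachable (W := W) (fun h => h.2.1 rfl) (fun x hx => hx.2.2)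
      (hSa s hs) (hSa t ht) hst ?_
    have h1 : (restrictTo G (W ∪ {s, t})).Reachable y z :=
      (hy'.2.symm.trans hz'.2).mono (restrictTo_mono G Set.subset_union_left)
    have h2 : (restrictTo G (W ∪ {s, t})).Adj s y := ⟨by simp, Or.inl hy'.1, hsy⟩
    have h3 : (restrictTo G (W ∪ {s, t})).Adj z t := ⟨Or.inl hz'.1, by simp, htz.symm⟩
    exact h2.reachable.trans (h1.trans h3.reachable)
  have hBU : B ⊆ U := Finset.filter_subset _ _
  have hSU : S ⊆ U := Finset.filter_subset _ _
  have hlt : S ∪ B ⊂ U := by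
    refine Finset.ssubset_iff_subset_ne.mpr ⟨Finset.union_subset hSU hBU, fun h => ?_⟩
    rw [← h, Finset.mem_union] at haU
    rcases haU with h | h
    · exact (hSa a h).ne rfl
    · exact (Finset.mem_filter.mp h).2.1.2.1 rfl
  have hSB : S ⊂ S ∪ B := by
    refine Finset.ssubset_iff_subset_ne.mpr ⟨Finset.subset_union_left, fun h => ?_⟩
    have : c ∈ S := h ▸ Finset.mem_union_right _ hcB
    exact (Finset.mem_filter.mp this).2.1 hcB
  -- Avoiding a prescribed clique pays off here: the vertex lies in `B`, not in the separator `S`,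
  -- so its neighbours in `U` all stay in `S ∪ B`.
  obtain ⟨v, hv, hvS, hclq⟩ := ih _ hlt S hSB hSclique
  have hvB : v ∈ B := by
    rcases Finset.mem_union.mp hv with h | h
    · exact absurd h hvS
    · exact h
  have hvW := (Finset.mem_filter.mp hvB).2.1
  have hsub : {w | w ∈ U ∧ G.Adj v w} ⊆ {w | w ∈ S ∪ B ∧ G.Adj v w} := by
    rintro w ⟨hwU, hvw⟩
    refine ⟨?_, hvw⟩
    by_cases hwB : w ∈ B
    · exact Finset.mem_union_right _ hwB
    · exact Finset.mem_union_left _ (Finset.mem_filter.mpr ⟨hwU, hwB, v, hvB, hvw.symm⟩)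
  refine ⟨v, hBU hvB, fun hvK => ?_, SimpleGraph.IsClique.subset hsub hclq⟩
  rcases haK with ha | hun
  · exact hvW.2.2 (hK ha hvK hvW.2.1.symm)
  · exact hvW.2.2 (hun v hvK a haU hvW.2.1.symm).symm

/-- Dirac's theorem: every nonempty induced subgraph of a chordal graph has a simplicial vertex. -/
theorem IsChordal.exists_simplicial {G : SimpleGraph V} (hG : IsChordal G) (U : Finset V)
    (hU : U.Nonempty) : ∃ v ∈ U, G.IsClique {w | w ∈ U ∧ G.Adj v w} := by
  obtain ⟨v, hv, -, h⟩ := hG.exists_simplicial_notMem_clique U ∅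
    (Finset.empty_ssubset.mpr hU) (by simp)
  exact ⟨v, hv, h⟩

end Chordal

end SparseSOS

namespace SparseSOS

/-! ### Clique decomposition of sparse positive semidefinite matrices -/

section Decomposition

/-- Cauchy–Schwarz for the form of a positive semidefinite matrix, one vector being a unit
vector. -/
theorem PosSemidef.sq_dotProduct_col_le {ι : Type*} [Fintype ι] [DecidableEq ι] {A : Matrix ι ι ℝ}
    (hA : A.PosSemidef) (x : ι → ℝ) (v : ι) :
    (x ⬝ᵥ A.col v) ^ 2 ≤ (x ⬝ᵥ A.mulVec x) * A v v := by
  have hsym : ∀ i j, A i j = A j i := fun i j => by simpa using (hA.isHermitian.apply i j).symm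
  have hquad : ∀ s : ℝ, 0 ≤ A v v * (s * s) + (2 * (x ⬝ᵥ A.col v)) * s + x ⬝ᵥ A.mulVec x := by
    intro s
    have h := hA.dotProduct_mulVec_nonneg (x + s • Pi.single v 1)
    have e1 : A.mulVec (Pi.single v 1) = A.col v := by simp
    have e2 : (Pi.single v (1 : ℝ)) ⬝ᵥ A.mulVec x = x ⬝ᵥ A.col v := by
      rw [single_one_dotProduct, dotProduct_comm]
      simp only [Matrix.mulVec, Matrix.col_def]
      congr 1
      ext j
      simp [hsym v j]
    simp only [star_trivial, Matrix.mulVec_add, Matrix.mulVec_smul, e1, dotProduct_add,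
      add_dotProduct, smul_dotProduct, dotProduct_smul, e2, smul_eq_mul,
      single_one_dotProduct, Matrix.col_apply] at h
    linarith
  have := discrim_le_zero hquad
  rw [discrim] at this
  linarith

/-- A positive semidefinite matrix with the sparsity pattern of a chordal graph is a sum of
matrices `w wᵀ` with `w` supported on a clique. -/
theorem IsChordal.mem_closure_vecMulVec {ι : Type*} [Fintype ι] [DecidableEq ι]
    {G : SimpleGraph ι} (hG : IsChordal G) {A : Matrix ι ι ℝ} (hA : A.PosSemidef)
    (hsp : ∀ i j, i ≠ j → ¬ G.Adj i j → A i j = 0) :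
    A ∈ AddSubmonoid.closure
      {M : Matrix ι ι ℝ | ∃ w : ι → ℝ, G.IsClique (Function.support w) ∧
        M = Matrix.vecMulVec w w} := by
  -- Induction on a set `U` containing the indices of all nonzero rows; each elimination step
  -- removes a simplicial vertex of `U`.
  suffices H : ∀ (U : Finset ι) (A : Matrix ι ι ℝ), A.PosSemidef →
      (∀ i j, i ≠ j → ¬ G.Adj i j → A i j = 0) → (∀ i j, i ∉ U → A i j = 0) →
      A ∈ AddSubmonoid.closure
        {M : Matrix ι ι ℝ | ∃ w : ι → ℝ, G.IsClique (Function.support w) ∧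
          M = Matrix.vecMulVec w w} from H Finset.univ A hA hsp (by simp)
  intro U
  induction U using Finset.strongInduction with
  | H U ih =>
  intro A hA hsp hU
  rcases U.eq_empty_or_nonempty with rfl | hne
  · have : A = 0 := by ext i j; exact hU i j (by simp)
    rw [this]
    exact zero_mem _
  obtain ⟨v, hv, hclq⟩ := hG.exists_simplicial U hne
  have hsym : ∀ i j, A i j = A j i := fun i j => by simpa using (hA.isHermitian.apply i j).symm
  have hvv : 0 ≤ A v v := hA.diag_nonneg
  have hzero : A v v = 0 → ∀ i, A i v = 0 := fun h i => by
    have := PosSemidef.sq_dotProduct_col_le hA (Pi.single i 1) v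
    rw [h, mul_zero, single_one_dotProduct, Matrix.col_apply] at this
    exact pow_eq_zero_iff two_ne_zero |>.mp (le_antisymm this (sq_nonneg _))
  -- The scaled pivot column. If `A v v = 0`, division by zero makes `w = 0`, which is harmless
  -- because then the whole column vanishes by `hzero`.
  set w : ι → ℝ := fun i => A i v / Real.sqrt (A v v) with hw
  have hww : ∀ i j, w i * w j = A i v * A j v / A v v := fun i j => by
    simp only [hw]
    rw [div_mul_div_comm, Real.mul_self_sqrt hvv]
  have hsupp : ∀ i, w i ≠ 0 → i ∈ U ∧ (i = v ∨ G.Adj v i) := fun i hi => by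
    have hAi : A i v ≠ 0 := fun h => hi (by simp [hw, h])
    refine ⟨by_contra fun h => hAi (hU i v h), ?_⟩
    by_contra! h
    exact hAi (hsp i v h.1 fun h' => h.2 h'.symm)
  have hwclq : G.IsClique (Function.support w) := by
    intro i hi j hj hij
    obtain ⟨hiU, hi⟩ := hsupp i hi
    obtain ⟨hjU, hj⟩ := hsupp j hj
    rcases hi with rfl | hi
    · rcases hj with rfl | hj
      · exact absurd rfl hij
      · exact hj
    · rcases hj with rfl | hj
      · exact hi.symm
      · exact hclq ⟨hiU, hi⟩ ⟨hjU, hj⟩ hij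
  have hsplit : A = (A - Matrix.vecMulVec w w) + Matrix.vecMulVec w w := by abel
  rw [hsplit]
  -- The Schur complement is positive semidefinite by Cauchy–Schwarz. It has no fill-in, because `w`
  -- lives on the clique formed by `v` and its neighbours in `U`.
  refine add_mem (ih (U.erase v) (Finset.erase_ssubset hv) _ ?_ ?_ ?_)
    (AddSubmonoid.subset_closure ⟨w, hwclq, rfl⟩)
  · refine Matrix.PosSemidef.of_dotProduct_mulVec_nonneg ?_ fun x => ?_
    · ext i j
      simp [Matrix.vecMulVec_apply, hsym i j, mul_comm]
    · have hcs := PosSemidef.sq_dotProduct_col_le hA x v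
      have hq := hA.dotProduct_mulVec_nonneg x
      simp only [star_trivial] at hq ⊢
      rw [Matrix.sub_mulVec, dotProduct_sub, Matrix.vecMulVec_mulVec]
      have hxw : x ⬝ᵥ w = (x ⬝ᵥ A.col v) / Real.sqrt (A v v) := by
        simp [hw, dotProduct, Finset.sum_div, mul_div_assoc]
      have hmul : x ⬝ᵥ (MulOpposite.op (w ⬝ᵥ x) • w) = (x ⬝ᵥ w) ^ 2 := by
        rw [op_smul_eq_smul, dotProduct_smul, dotProduct_comm w x, smul_eq_mul, sq]
      rw [hmul, hxw, div_pow, Real.sq_sqrt hvv, sub_nonneg]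
      exact div_le_of_le_mul₀ hvv hq hcs
  · intro i j hij hadj
    simp only [Matrix.sub_apply, Matrix.vecMulVec_apply, hsp i j hij hadj]
    by_contra h
    have hi : w i ≠ 0 := fun h' => h (by simp [h'])
    have hj : w j ≠ 0 := fun h' => h (by simp [h'])
    exact hadj (hwclq hi hj hij)
  · intro i j hi
    rw [Matrix.sub_apply, Matrix.vecMulVec_apply, hww]
    by_cases hiv : i = v
    · subst hiv
      rcases eq_or_ne (A i i) 0 with h0 | h0
      · rw [hsym i j, hzero h0 j, h0]; simp
      · rw [mul_div_assoc, mul_div_cancel₀ _ h0, hsym i j, sub_self]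
    · have hiU : i ∉ U := fun h => hi (Finset.mem_erase.mpr ⟨hiv, h⟩)
      rw [hU i j hiU, hU i v hiU]; simp

end Decomposition

end SparseSOS

namespace SparseSOS

/-! ### Pólya's theorem for matrices -/

section Polya

open scoped Nat

/-- The `t`-deformation `y (y - t) ⋯ (y - (k - 1) t)` of `y ^ k`. -/
noncomputable def stepPow (y t : ℝ) (k : ℕ) : ℝ := ∏ l ∈ Finset.range k, (y - l * t)

theorem stepPow_zero (y : ℝ) (k : ℕ) : stepPow y 0 k = y ^ k := by simp [stepPow]

theorem stepPow_natCast (b k : ℕ) : stepPow b 1 k = b.descFactorial k := by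
  induction k with
  | zero => simp [stepPow]
  | succ k ih =>
    rw [stepPow, Finset.prod_range_succ, ← stepPow, ih, Nat.descFactorial_succ, mul_one, mul_comm]
    rcases le_or_gt k b with h | h
    · push_cast [Nat.cast_sub h]; rfl
    · simp [Nat.descFactorial_of_lt h]

theorem stepPow_mul (c y t : ℝ) (k : ℕ) : stepPow (c * y) (c * t) k = c ^ k * stepPow y t k := by
  simp only [stepPow]
  calc _ = ∏ l ∈ Finset.range k, c * (y - l * t) := Finset.prod_congr rfl fun l _ => by ring
    _ = _ := by simp [Finset.prod_mul_distrib]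

variable {σ : Type*} [Fintype σ]

/-- The value at `y` of the polynomial `p`, with powers deformed by the step `t`. -/
noncomputable def stepEval (p : MvPolynomial σ ℝ) (t : ℝ) (y : σ → ℝ) : ℝ :=
  ∑ α ∈ p.support, coeff α p * ∏ k, stepPow (y k) t (α k)

theorem stepEval_zero (p : MvPolynomial σ ℝ) (y : σ → ℝ) : stepEval p 0 y = eval y p := by
  simp only [stepEval, stepPow_zero, eval_eq']

theorem continuous_stepEval (p : MvPolynomial σ ℝ) :
    Continuous fun z : ℝ × (σ → ℝ) => stepEval p z.1 z.2 := by
  unfold stepEval stepPow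
  fun_prop

/-- Every factor `y - l t` is linear in `(y, t)`. With `t = 1 / c` this moves integer exponents to
the simplex; with `c = 0` it gives the value at the origin. -/
theorem stepEval_smul {p : MvPolynomial σ ℝ} {d : ℕ} (hp : p.IsHomogeneous d) (c t : ℝ)
    (y : σ → ℝ) : stepEval p (c * t) (fun k => c * y k) = c ^ d * stepEval p t y := by
  simp only [stepEval, stepPow_mul, Finset.prod_mul_distrib, Finset.prod_pow_eq_pow_sum,
    Finset.mul_sum]
  refine Finset.sum_congr rfl fun α hα => ?_
  have : ∑ i, α i = d := by
    rw [← Finsupp.degree_eq_sum, Finsupp.degree_eq_weight_one]; exact hp (mem_support_iff.mp hα)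
  rw [this]
  ring

/-- The multinomial theorem with denominators cleared. -/
theorem coeff_sum_X_pow_mul_factorial (N : ℕ) (γ : σ →₀ ℕ) :
    coeff γ ((∑ i, X i : MvPolynomial σ ℝ) ^ N) * ((∏ i, (γ i)! : ℕ) : ℝ) =
      if γ.degree = N then (N ! : ℝ) else 0 := by
  have h := coeff_linearCombination_X_pow_of_fintype (R := ℝ) (fun _ : σ => 1) γ N
  simp only [one_smul, one_pow] at h
  rw [h]
  have hdeg : (γ.sum fun _ m => m) = γ.degree := rfl
  rw [hdeg]
  split_ifs with hN
  · have hm := Nat.multinomial_spec (Finset.univ : Finset σ) γ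
    rw [← Finsupp.degree_eq_sum, hN] at hm
    rw [← hm, ← Finsupp.multinomial_of_support_subset (Finset.subset_univ _)]
    simp [Finsupp.prod, mul_comm]
  · simp

/-- Pólya's formula for the coefficients of `(∑ Xᵢ) ^ N * p`. -/
theorem coeff_sum_X_pow_mul {p : MvPolynomial σ ℝ} {d : ℕ} (hp : p.IsHomogeneous d) (N : ℕ)
    (β : σ →₀ ℕ) (hβ : β.degree = N + d) :
    coeff β ((∑ i, X i) ^ N * p) * ((∏ i, (β i)! : ℕ) : ℝ) =
      N ! * stepEval p 1 (fun k => β k) := by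
  classical
  conv_lhs => rw [p.as_sum, Finset.mul_sum, coeff_sum]
  simp only [coeff_mul_monomial', stepEval, stepPow_natCast, Finset.mul_sum, Finset.sum_mul]
  refine Finset.sum_congr rfl fun α hα => ?_
  have hαd : α.degree = d := by
    rw [Finsupp.degree_eq_weight_one]
    exact hp (mem_support_iff.mp hα)
  split_ifs with h
  -- The coefficient of `X^(β - α)` is `N! / (β - α)!`, and `β!` is `(β - α)!` times the falling
  -- factorials of `β`.
  · have hdeg : (β - α).degree = N := by
      have : (β - α).degree + α.degree = β.degree := by
        rw [← map_add, tsub_add_cancel_of_le h]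
      omega
    have hc := coeff_sum_X_pow_mul_factorial N (β - α)
    rw [if_pos hdeg] at hc
    rw [← hc]
    have : ∏ i, (β i)! = (∏ i, ((β - α) i)!) * ∏ i, (β i).descFactorial (α i) := by
      rw [← Finset.prod_mul_distrib]
      exact Finset.prod_congr rfl fun i _ => (Nat.factorial_mul_descFactorial (h i)).symm
    rw [this]
    push_cast
    ring
  -- Here `X^α` does not divide `X^β`, and correspondingly a falling factorial vanishes.
  · obtain ⟨i, hi⟩ : ∃ i, β i < α i := by
      by_contra! h'
      exact h h'
    rw [Finset.prod_eq_zero (f := fun k => (((β k).descFactorial (α k) : ℕ) : ℝ))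
      (Finset.mem_univ i) (by simp [Nat.descFactorial_of_lt hi])]
    simp

theorem continuous_stepEval_dotProduct {ι : Type*} [Fintype ι]
    (Q : Matrix ι ι (MvPolynomial σ ℝ)) :
    Continuous fun u : ℝ × ((σ → ℝ) × (ι → ℝ)) =>
      u.2.2 ⬝ᵥ (Q.map fun q => stepEval q u.1 u.2.1).mulVec u.2.2 := by
  have hq : ∀ q : MvPolynomial σ ℝ,
      Continuous fun u : ℝ × ((σ → ℝ) × (ι → ℝ)) => stepEval q u.1 u.2.1 := fun q =>
    Continuous.comp (g := fun z : ℝ × (σ → ℝ) => stepEval q z.1 z.2) (continuous_stepEval q)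
      (f := fun u : ℝ × ((σ → ℝ) × (ι → ℝ)) => (u.1, u.2.1)) (by fun_prop)
  have hv : Continuous fun u : ℝ × ((σ → ℝ) × (ι → ℝ)) => u.2.2 := by fun_prop
  exact hv.dotProduct (Continuous.matrix_mulVec
    (continuous_matrix fun i j => hq (Q i j)) hv)

/-- Pólya's theorem for matrices: if the homogeneous symmetric matrix `Q` is positive definite on
the simplex, the coefficient matrices of `(∑ Xᵢ) ^ N • Q` are positive definite for large `N`. -/
theorem polya_matrix {ι : Type*} [Fintype ι] (Q : Matrix ι ι (MvPolynomial σ ℝ)) (d : ℕ)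
    (hQ : ∀ i j, (Q i j).IsHomogeneous d) (hsymm : Q.IsSymm)
    (hpos : ∀ y ∈ stdSimplex ℝ σ, (Q.map (eval y)).PosDef) :
    ∀ᶠ N : ℕ in Filter.atTop, ∀ β : σ →₀ ℕ, β.degree = N + d →
      (Q.map fun q => coeff β ((∑ i, X i) ^ N * q)).PosDef := by
  have hcpt : IsCompact (stdSimplex ℝ σ ×ˢ Metric.sphere (0 : ι → ℝ) 1) :=
    (isCompact_stdSimplex ℝ σ).prod (isCompact_sphere _ _)
  -- At `t = 0` the form is that of `Q`, positive on a compact set; by continuity it stays positive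
  -- there for all small `t`, uniformly.
  have hev : ∀ᶠ t : ℝ in nhds 0, ∀ z ∈ stdSimplex ℝ σ ×ˢ Metric.sphere (0 : ι → ℝ) 1,
      0 < z.2 ⬝ᵥ (Q.map fun q => stepEval q t z.1).mulVec z.2 := by
    refine hcpt.eventually_forall_of_forall_eventually fun z hz => ?_
    refine (continuous_stepEval_dotProduct Q).continuousAt.eventually (lt_mem_nhds ?_)
    have hz2 : z.2 ≠ 0 := by
      rintro h
      have := hz.2
      simp [h] at this
    have := (hpos z.1 hz.1).dotProduct_mulVec_pos hz2
    simp only [stepEval_zero]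
    simpa using this
  have hlim : Filter.Tendsto (fun N : ℕ => 1 / ((N + d : ℕ) : ℝ)) Filter.atTop (nhds 0) :=
    tendsto_one_div_atTop_nhds_zero_nat.comp (Filter.tendsto_add_atTop_nat d)
  filter_upwards [hlim.eventually hev, Filter.eventually_ge_atTop 1] with N hN hN1 β hβ
  set M : ℝ := ((N + d : ℕ) : ℝ) with hM
  have hMpos : 0 < M := by rw [hM]; exact_mod_cast by omega
  refine Matrix.PosDef.of_dotProduct_mulVec_pos ?_ fun v hv => ?_
  · ext i j
    simp [hsymm.apply i j]
  set y : σ → ℝ := fun k => β k / M with hy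
  have hysimp : y ∈ stdSimplex ℝ σ := by
    refine ⟨fun k => by positivity, ?_⟩
    simp only [hy]
    rw [← Finset.sum_div, div_eq_one_iff_eq hMpos.ne', hM, ← hβ, Finsupp.degree_eq_sum]
    push_cast
    rfl
  set u : ι → ℝ := ‖v‖⁻¹ • v with hu
  have hvn : 0 < ‖v‖ := norm_pos_iff.mpr hv
  have hv' : v = ‖v‖ • u := by rw [hu, smul_smul, mul_inv_cancel₀ hvn.ne', one_smul]
  have hmem : (y, u) ∈ stdSimplex ℝ σ ×ˢ Metric.sphere (0 : ι → ℝ) 1 := by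
    refine ⟨hysimp, ?_⟩
    simp [hu, norm_smul, hvn.ne']
  have hposu := hN _ hmem
  set F : ℝ := ((∏ i, (β i)! : ℕ) : ℝ) with hF
  have hFpos : 0 < F := by rw [hF]; exact_mod_cast Finset.prod_pos fun i _ => Nat.factorial_pos _
  -- Up to a positive factor, the coefficient matrix at `β` is the deformation of `Q` with step `1 /
  -- M` at the simplex point `β / M`.
  have hcoef : (Q.map fun q => coeff β ((∑ i, X i) ^ N * q)) =
      (N ! * M ^ d / F) • Q.map fun q => stepEval q (1 / M) y := by
    ext i j
    simp only [Matrix.map_apply, Matrix.smul_apply, smul_eq_mul]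
    have h1 := coeff_sum_X_pow_mul (hQ i j) N β hβ
    have h2 := stepEval_smul (hQ i j) M (1 / M) y
    rw [mul_one_div_cancel hMpos.ne',
      show (fun k => M * y k) = fun k => (β k : ℝ) by
        ext k; simp only [hy]; field_simp] at h2
    rw [h2] at h1
    rw [div_mul_eq_mul_div, eq_div_iff hFpos.ne', h1]
    ring
  rw [hcoef, star_trivial, Matrix.smul_mulVec, dotProduct_smul, smul_eq_mul]
  refine mul_pos (by positivity) ?_
  rw [hv', Matrix.mulVec_smul, dotProduct_smul, smul_dotProduct, smul_eq_mul, smul_eq_mul]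
  exact mul_pos hvn (mul_pos hvn hposu)

end Polya

end SparseSOS

namespace SparseSOS

/-! ### Sparse SOS certificates for even positive definite matrices -/

section SOS

variable {n : ℕ}

theorem PolyMatrix.degree_le_iff {ι κ : Type*} [Fintype ι] [Fintype κ] {S : PolyMatrix n ι κ}
    {d : ℕ} : S.degree ≤ d ↔ ∀ i j, (S i j).totalDegree ≤ d := by
  simp [PolyMatrix.degree, Finset.sup_le_iff]

theorem PolyMatrix.IsSOS.zero {ι : Type*} : (0 : PolyMatrix n ι ι).IsSOS :=
  ⟨0, 0, by simp⟩

theorem PolyMatrix.IsSOS.add {ι : Type*} {S T : PolyMatrix n ι ι} (hS : S.IsSOS) (hT : T.IsSOS) :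
    (S + T).IsSOS := by
  obtain ⟨r, H, rfl⟩ := hS
  obtain ⟨s, K, rfl⟩ := hT
  refine ⟨r + s, Matrix.of fun i j => Fin.append (fun a => H a j) (fun a => K a j) i, ?_⟩
  ext1 i j
  simp [Matrix.mul_apply, Fin.sum_univ_add]

theorem zero_mem_sosCone (ι : Type*) [Fintype ι] (d : ℕ) : (0 : PolyMatrix n ι ι) ∈ sosCone n ι d :=
  ⟨PolyMatrix.IsSOS.zero, PolyMatrix.degree_le_iff.mpr fun i j => by simp⟩

theorem add_mem_sosCone {ι : Type*} [Fintype ι] {d : ℕ} {S T : PolyMatrix n ι ι}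
    (hS : S ∈ sosCone n ι d) (hT : T ∈ sosCone n ι d) : S + T ∈ sosCone n ι d :=
  ⟨hS.1.add hT.1, PolyMatrix.degree_le_iff.mpr fun i j => (totalDegree_add _ _).trans
    (max_le (PolyMatrix.degree_le_iff.mp hS.2 i j) (PolyMatrix.degree_le_iff.mp hT.2 i j))⟩

/-- The matrices `∑ E_Cᵀ S_C E_C`, summed over the maximal cliques of `G`, with the `S_C` SOS of
degree at most `D`. -/
noncomputable def sparseSOS (n : ℕ) {m : ℕ} (G : SimpleGraph (Fin m)) (D : ℕ) :
    AddSubmonoid (PolyMatrix n (Fin m) (Fin m)) where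
  carrier := {M | ∃ S : (C : Finset (Fin m)) → PolyMatrix n C C,
    M = ∑ C ∈ maximalCliques G, (inflation n C).transpose * S C * inflation n C ∧
      ∀ C ∈ maximalCliques G, S C ∈ sosCone n C D}
  zero_mem' := ⟨fun _ => 0, by simp, fun C _ => zero_mem_sosCone C D⟩
  add_mem' := by
    rintro _ _ ⟨S, rfl, hS⟩ ⟨T, rfl, hT⟩
    refine ⟨fun C => S C + T C, ?_, fun C hC => add_mem_sosCone (hS C hC) (hT C hC)⟩
    simp [Matrix.mul_add, Matrix.add_mul, Finset.sum_add_distrib]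

theorem exists_maximalClique_superset {m : ℕ} (G : SimpleGraph (Fin m)) (s : Set (Fin m))
    (hs : G.IsClique s) : ∃ C ∈ maximalCliques G, s ⊆ (C : Set (Fin m)) := by
  classical
  obtain ⟨C, hsC, hC⟩ := Finite.exists_le_maximal
    (p := fun t : Finset (Fin m) => G.IsClique (t : Set (Fin m))) (a := s.toFinset) (by simpa)
  exact ⟨C, by simp [maximalCliques, hC], fun x hx => hsC (by simpa using hx)⟩

/-- The SOS matrix `x^(2β) w wᵀ` with `w` supported on a clique. -/
theorem monomial_vecMulVec_mem_sparseSOS {m : ℕ} (G : SimpleGraph (Fin m)) {D : ℕ}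
    (β : Fin n →₀ ℕ) (hβ : 2 * β.degree ≤ D) (w : Fin m → ℝ)
    (hw : G.IsClique (Function.support w)) :
    (Matrix.vecMulVec w w).map (monomial (2 • β)) ∈ sparseSOS n G D := by
  classical
  obtain ⟨C₀, hC₀, hsub⟩ := exists_maximalClique_superset G _ hw
  let H : (C : Finset (Fin m)) → PolyMatrix n (Fin 1) C :=
    fun C => Matrix.of fun _ j => monomial β (w j)
  have hmon : ∀ i j, monomial β (w i) * monomial β (w j) = monomial (2 • β) (w i * w j) :=
    fun i j => by rw [monomial_mul, two_smul]
  refine ⟨fun C => if C = C₀ then (H C).transpose * H C else 0, ?_, fun C hC => ?_⟩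
  · rw [Finset.sum_eq_single C₀ (fun C _ hC => by simp [hC]) (fun h => absurd hC₀ h)]
    simp only [if_true]
    have hHE : H C₀ * inflation n C₀ = Matrix.of fun _ j => monomial β (w j) := by
      ext1 a j
      simp only [H, inflation, Matrix.mul_apply, Matrix.of_apply, mul_ite, mul_one, mul_zero]
      by_cases hj : j ∈ C₀
      · rw [Finset.sum_eq_single ⟨j, hj⟩ (fun b _ hb => if_neg fun h => hb (Subtype.ext h))
          (fun h => absurd (Finset.mem_univ _) h)]
        simp
      · have hne : ∀ b : C₀, (b : Fin m) ≠ j := fun b h => hj (h ▸ b.2)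
        rw [Finset.sum_eq_zero fun b _ => if_neg (hne b)]
        have : w j = 0 := by
          by_contra h
          exact hj (hsub h)
        simp [this]
    rw [← Matrix.mul_assoc, ← Matrix.transpose_mul, hHE, Matrix.mul_assoc, hHE]
    ext1 i j
    simp [Matrix.mul_apply, hmon, Matrix.vecMulVec_apply]
  · simp only
    split_ifs
    · refine ⟨⟨1, H C, rfl⟩, PolyMatrix.degree_le_iff.mpr fun i j => ?_⟩
      simp only [H, Matrix.mul_apply, Matrix.transpose_apply, Matrix.of_apply, hmon,
        Finset.univ_unique, Finset.sum_const, Finset.card_singleton, one_smul]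
      refine (totalDegree_monomial_le _ _).trans (le_trans (le_of_eq ?_) hβ)
      change (2 • β).degree = _
      simp
    · exact zero_mem_sosCone C D

/-- Multiplication by `x^(2β)` is additive, so the clique decomposition of `A` reduces this to the
rank-one case. -/
theorem monomial_map_mem_sparseSOS {m : ℕ} {G : SimpleGraph (Fin m)} (hG : IsChordal G) {D : ℕ}
    (β : Fin n →₀ ℕ) (hβ : 2 * β.degree ≤ D) {A : Matrix (Fin m) (Fin m) ℝ} (hA : A.PosSemidef)
    (hsp : ∀ i j, i ≠ j → ¬ G.Adj i j → A i j = 0) :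
    A.map (monomial (2 • β)) ∈ sparseSOS n G D := by
  have hmem := hG.mem_closure_vecMulVec hA hsp
  clear hA hsp
  induction hmem using AddSubmonoid.closure_induction with
  | mem M hM =>
    obtain ⟨w, hw, rfl⟩ := hM
    exact monomial_vecMulVec_mem_sparseSOS G β hβ w hw
  | zero => rw [Matrix.map_zero _ (map_zero _)]; exact zero_mem _
  | add M N _ _ hM hN => rw [Matrix.map_add _ (map_add _)]; exact add_mem hM hN

/-- Halving all exponents; this is the substitution `yₖ = xₖ²` that brings in the simplex. -/
theorem exists_expand_two_eq {σ : Type*} {p : MvPolynomial σ ℝ}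
    (hp : ∀ α ∈ p.support, ∀ k, Even (α k)) : ∃ q, expand 2 q = p := by
  change p ∈ (expand 2 : MvPolynomial σ ℝ →ₐ[ℝ] MvPolynomial σ ℝ).range
  rw [p.as_sum]
  refine sum_mem fun α hα => ⟨monomial (α.mapRange (· / 2) (by simp)) (coeff α p), ?_⟩
  have : 2 • α.mapRange (· / 2) (by simp) = α := by
    ext k
    have := hp α hα k
    simp
    grind
  change expand 2 _ = _
  rw [expand_monomial, this]

/-- A homogeneous even matrix that is positive definite away from the origin is, after
multiplication by a high power of `∑ xᵢ²`, a sum of clique-supported SOS matrices. -/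
theorem eventually_smul_mem_sparseSOS {m : ℕ} (hn : 1 ≤ n) {G : SimpleGraph (Fin m)}
    (hG : IsChordal G) (M : PolyMatrix n (Fin m) (Fin m)) (hsymm : M.IsSymm)
    (hsp : ∀ i j, i ≠ j → ¬ G.Adj i j → M i j = 0) (hhom : M.IsHomogeneous) (heven : M.IsEven)
    (hpos : ∀ x : Fin n → ℝ, x ≠ 0 → (M.evalAt x).PosDef) :
    ∀ᶠ ν : ℕ in Filter.atTop, ∀ D, 2 * ν + M.degree ≤ D →
      ((∑ i : Fin n, (X i : MvPolynomial (Fin n) ℝ) ^ 2) ^ ν) • M ∈ sparseSOS n G D := by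
  classical
  rcases isEmpty_or_nonempty (Fin m) with hm | ⟨⟨i₀⟩⟩
  · refine Filter.Eventually.of_forall fun ν D _ => ?_
    rw [Subsingleton.elim ((_ : MvPolynomial (Fin n) ℝ) • M) 0]
    exact zero_mem _
  choose Q hQ using fun i j => exists_expand_two_eq (heven i j)
  have hinj : Function.Injective (expand 2 : MvPolynomial (Fin n) ℝ →ₐ[ℝ] _) :=
    expand_injective two_pos
  obtain ⟨d, hd⟩ := hhom
  have hone : (fun _ => 1 : Fin n → ℝ) ≠ 0 := fun h => by
    simpa using congrFun h ⟨0, hn⟩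
  -- A nonzero entry ties the homogeneity exponent `d` to the actual degree of `M`, and forces `d`
  -- to be even.
  have hM₀ : M i₀ i₀ ≠ 0 := fun h => by
    have := (hpos _ hone).diag_pos (i := i₀)
    simp [PolyMatrix.evalAt, h] at this
  have hdeg : d ≤ M.degree := by
    rw [← (hd i₀ i₀).totalDegree hM₀]
    exact PolyMatrix.degree_le_iff.mp le_rfl i₀ i₀
  have hdQ : ∀ i j (α : Fin n →₀ ℕ), coeff α (Q i j) ≠ 0 → 2 * α.degree = d := by
    intro i j α hα
    rw [← coeff_expand_smul 2 two_ne_zero, hQ] at hα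
    have := hd i j hα
    rw [show Finsupp.weight 1 (2 • α) = (2 • α).degree from
      (DFunLike.congr_fun Finsupp.degree_eq_weight_one _).symm] at this
    simpa using this
  obtain ⟨e, rfl⟩ : ∃ e, d = 2 * e := by
    have h0 : Q i₀ i₀ ≠ 0 := fun h => hM₀ (by rw [← hQ, h, map_zero])
    obtain ⟨α, hα⟩ := ne_zero_iff.mp h0
    exact ⟨_, (hdQ _ _ α hα).symm⟩
  have hQhom : ∀ i j, (Q i j).IsHomogeneous e := by
    intro i j α hα
    have := hdQ i j α hα
    rw [Finsupp.degree_eq_weight_one] at this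
    change Finsupp.weight (fun _ => 1) α = e
    omega
  have hQsymm : (Matrix.of Q).IsSymm := by
    ext1 i j
    exact hinj (by simpa [hQ] using hsymm.apply i j)
  have hQsp : ∀ i j, i ≠ j → ¬ G.Adj i j → Q i j = 0 := fun i j hij hadj =>
    hinj (by rw [hQ, hsp i j hij hadj, map_zero])
  -- A point `y` of the simplex is the entrywise square of `√y`, which is nonzero.
  have hQpos : ∀ y ∈ stdSimplex ℝ (Fin n), ((Matrix.of Q).map (eval y)).PosDef := by
    intro y hy
    have hx : (fun k => Real.sqrt (y k)) ≠ 0 := fun h => by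
      have h0 : ∀ k, y k = 0 := fun k => by
        have := congrFun h k
        exact (Real.sqrt_eq_zero (hy.1 k)).mp this
      have := hy.2
      simp [h0] at this
    convert hpos _ hx using 1
    ext i j
    simp only [Matrix.map_apply, Matrix.of_apply, PolyMatrix.evalAt, ← hQ, eval_expand]
    congr 2
    ext k
    simp [Real.sq_sqrt (hy.1 k)]
  filter_upwards [polya_matrix (Matrix.of Q) e hQhom hQsymm hQpos] with ν hν D hD
  set T : Finset (Fin n →₀ ℕ) := Finset.univ.biUnion fun i => Finset.univ.biUnion fun j =>
    ((∑ i, X i) ^ ν * Q i j).support with hT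
  have hlin : (∑ i : Fin n, (X i : MvPolynomial (Fin n) ℝ)).IsHomogeneous 1 :=
    IsHomogeneous.sum _ _ _ fun i _ => isHomogeneous_X _ _
  have hTdeg : ∀ β ∈ T, β.degree = ν + e := by
    intro β hβ
    simp only [hT, Finset.mem_biUnion] at hβ
    obtain ⟨i, -, j, -, hβ⟩ := hβ
    have := ((hlin.pow ν).mul (hQhom i j)) (mem_support_iff.mp hβ)
    rw [Finsupp.degree_eq_weight_one, ← one_mul ν]
    exact this
  have hsum : ((∑ i : Fin n, (X i : MvPolynomial (Fin n) ℝ) ^ 2) ^ ν) • M =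
      ∑ β ∈ T, ((Matrix.of Q).map fun q => coeff β ((∑ i, X i) ^ ν * q)).map
        (monomial (2 • β)) := by
    ext1 i j
    rw [Matrix.smul_apply, smul_eq_mul, Matrix.sum_apply]
    have h1 : (∑ i : Fin n, (X i : MvPolynomial (Fin n) ℝ) ^ 2) ^ ν * M i j =
        expand 2 ((∑ i, X i) ^ ν * Q i j) := by
      simp [hQ]
    have h2 : (∑ i, X i) ^ ν * Q i j =
        ∑ β ∈ T, monomial β (coeff β ((∑ i, X i) ^ ν * Q i j)) := by
      refine (as_sum _).trans (Finset.sum_subset ?_ fun β _ hβ => by rw [notMem_support_iff.mp hβ, map_zero])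
      exact fun β hβ => Finset.mem_biUnion.mpr ⟨i, Finset.mem_univ _,
        Finset.mem_biUnion.mpr ⟨j, Finset.mem_univ _, hβ⟩⟩
    rw [h1]
    refine (congrArg (expand 2) h2).trans ((map_sum _ _ _).trans ?_)
    exact Finset.sum_congr rfl fun β _ => expand_monomial _ _ _
  rw [hsum]
  refine sum_mem fun β hβ => monomial_map_mem_sparseSOS hG β ?_ (hν β (hTdeg β hβ)).posSemidef ?_
  · rw [hTdeg β hβ]; omega
  · intro i j hij hadj
    simp [hQsp i j hij hadj]

end SOS

/-! ### Soundness of the relaxation and dependence on the parameter -/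

section Relaxation

variable {n m ℓ : ℕ}

theorem PolyMatrix.IsSOS.posSemidef_evalAt {ι : Type*} [Fintype ι] {S : PolyMatrix n ι ι}
    (hS : S.IsSOS) (x : Fin n → ℝ) : (S.evalAt x).PosSemidef := by
  obtain ⟨r, H, rfl⟩ := hS
  have : PolyMatrix.evalAt (H.transpose * H) x =
      (H.map (eval x)).conjTranspose * H.map (eval x) := by
    rw [PolyMatrix.evalAt, Matrix.map_mul, Matrix.conjTranspose_eq_transpose_of_trivial,
      Matrix.transpose_map]
  rw [this]
  exact Matrix.posSemidef_conjTranspose_mul_self _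

theorem posSemidef_evalAt_of_mem_sparseSOS {G : SimpleGraph (Fin m)} {D : ℕ}
    {M : PolyMatrix n (Fin m) (Fin m)} (hM : M ∈ sparseSOS n G D) (x : Fin n → ℝ) :
    (M.evalAt x).PosSemidef := by
  obtain ⟨S, rfl, hS⟩ := hM
  have : PolyMatrix.evalAt (∑ C ∈ maximalCliques G,
        (inflation n C).transpose * S C * inflation n C) x =
      ∑ C ∈ maximalCliques G, ((inflation n C).map (eval x)).conjTranspose * (S C).evalAt x *
        (inflation n C).map (eval x) := by
    have hC : ∀ C : Finset (Fin m),
        PolyMatrix.evalAt ((inflation n C).transpose * S C * inflation n C) x =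
          ((inflation n C).map (eval x)).conjTranspose * (S C).evalAt x *
            (inflation n C).map (eval x) := fun C => by
      rw [PolyMatrix.evalAt, Matrix.map_mul, Matrix.map_mul,
        Matrix.conjTranspose_eq_transpose_of_trivial, Matrix.transpose_map]
      rfl
    simp only [← hC]
    ext i j
    rw [PolyMatrix.evalAt, Matrix.map_apply, Matrix.sum_apply, Matrix.sum_apply, map_sum]
    rfl
  rw [this]
  exact Matrix.posSemidef_sum _ fun C hC =>
    ((hS C hC).1.posSemidef_evalAt x).conjTranspose_mul_mul_same _

/-- `M(0) = 0^d M(y)`, where `0^0 = 1` covers the constant case. -/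
theorem PolyMatrix.IsHomogeneous.posSemidef_evalAt_zero {ι : Type*} [Fintype ι]
    {M : PolyMatrix n ι ι} (hM : M.IsHomogeneous) {y : Fin n → ℝ}
    (hy : (M.evalAt y).PosSemidef) : (M.evalAt 0).PosSemidef := by
  obtain ⟨d, hd⟩ := hM
  have : M.evalAt 0 = (0 : ℝ) ^ d • M.evalAt y := by
    ext i j
    have := stepEval_smul (hd i j) 0 0 y
    simp only [zero_mul, stepEval_zero] at this
    simpa [PolyMatrix.evalAt] using this
  rw [this]
  exact hy.smul (by positivity)

/-- The degree can drop for particular `lam`; this is why `eventually_smul_mem_sparseSOS` allows any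
bound `D` above `2ν` plus the degree. -/
theorem AffinePolyMatrix.degree_at_le (P : AffinePolyMatrix n m ℓ) (lam : Fin ℓ → ℝ) :
    (P.at lam).degree ≤ P.degree := by
  refine PolyMatrix.degree_le_iff.mpr fun i j => ?_
  rw [AffinePolyMatrix.at, Matrix.add_apply, Matrix.sum_apply]
  refine (totalDegree_add _ _).trans (max_le ?_ ?_)
  · exact (PolyMatrix.degree_le_iff.mp le_rfl i j).trans (le_max_left _ _)
  · refine totalDegree_finsetSum_le fun k _ => (totalDegree_smul_le _ _).trans ?_
    refine (PolyMatrix.degree_le_iff.mp le_rfl i j).trans (le_trans ?_ (le_max_right _ _))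
    exact Finset.le_sup (f := fun k => (P.coeff k).degree) (Finset.mem_univ k)

theorem AffinePolyMatrix.at_convexComb (P : AffinePolyMatrix n m ℓ) (lam mu : Fin ℓ → ℝ)
    {s t : ℝ} (hst : s + t = 1) : P.at (s • lam + t • mu) = s • P.at lam + t • P.at mu := by
  have hc : P.const = s • P.const + t • P.const := by rw [← add_smul, hst, one_smul]
  simp only [AffinePolyMatrix.at, Pi.add_apply, Pi.smul_apply, smul_eq_mul, add_smul,
    Finset.sum_add_distrib, smul_add, Finset.smul_sum, smul_smul]
  conv_lhs => rw [hc]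
  abel

theorem le_degreeBound (P : AffinePolyMatrix n m ℓ) (ν : ℕ) :
    2 * ν + P.degree ≤ degreeBound P ν := by
  have hne : {d : ℕ | Even d ∧ 2 * ν + P.degree ≤ d}.Nonempty :=
    ⟨2 * (2 * ν + P.degree), even_two_mul _, by omega⟩
  exact (Nat.sInf_mem hne).2

/-- Off the origin one divides by the positive weight. The origin, where the weight may vanish, is
reached by homogeneity from a nonzero point, which exists since `n ≥ 1`. -/
theorem posSemidef_of_isSparseFeasible (hn : 1 ≤ n) {G : SimpleGraph (Fin m)}
    {P : AffinePolyMatrix n m ℓ} {ν : ℕ} {lam : Fin ℓ → ℝ}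
    (hhom : (P.at lam).IsHomogeneous) {S : (C : Finset (Fin m)) → PolyMatrix n C C}
    (hS : IsSparseFeasible G P ν lam S) (x : Fin n → ℝ) : ((P.at lam).evalAt x).PosSemidef := by
  have hne : ∀ x : Fin n → ℝ, x ≠ 0 → ((P.at lam).evalAt x).PosSemidef := by
    intro x hx
    have hmem : ((∑ i : Fin n, (X i : MvPolynomial (Fin n) ℝ) ^ 2) ^ ν) • P.at lam ∈
      sparseSOS n G (degreeBound P ν) := ⟨S, hS⟩
    have hpsd := posSemidef_evalAt_of_mem_sparseSOS hmem x
    set c : ℝ := (∑ i, x i ^ 2) ^ ν with hc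
    have hcpos : 0 < c := by
      obtain ⟨k, hk⟩ := Function.ne_iff.mp hx
      refine pow_pos (Finset.sum_pos' (fun i _ => sq_nonneg _) ⟨k, Finset.mem_univ _, ?_⟩) _
      exact sq_pos_of_ne_zero hk
    have : (P.at lam).evalAt x = c⁻¹ • PolyMatrix.evalAt
        (((∑ i : Fin n, (X i : MvPolynomial (Fin n) ℝ) ^ 2) ^ ν) • P.at lam) x := by
      ext i j
      simp [PolyMatrix.evalAt, ← hc, inv_mul_cancel_left₀ hcpos.ne']
    rw [this]
    exact hpsd.smul (by positivity)
  rcases eq_or_ne x 0 with rfl | hx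
  · refine hhom.posSemidef_evalAt_zero (hne (fun _ => 1) fun h => ?_)
    simpa using congrFun h ⟨0, hn⟩
  · exact hne x hx

end Relaxation

end SparseSOS

/-! ### Convergence of the optimal values -/

theorem mainTheorem6 (n m ℓ : ℕ) (hn : 1 ≤ n)
    (G : SimpleGraph (Fin m)) (hG : SparseSOS.IsChordal G)
    (P : SparseSOS.AffinePolyMatrix n m ℓ)
    (hsymm : ∀ lam : Fin ℓ → ℝ, (P.at lam).IsSymm)
    (hsparse : ∀ (lam : Fin ℓ → ℝ) (i j : Fin m), i ≠ j → ¬ G.Adj i j → P.at lam i j = 0)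
    (hhom : ∀ lam : Fin ℓ → ℝ, (P.at lam).IsHomogeneous)
    (heven : ∀ lam : Fin ℓ → ℝ, (P.at lam).IsEven)
    (b : (Fin ℓ → ℝ) → ℝ) (hb : ConvexOn ℝ Set.univ b)
    (hstrict : ∃ lam₀ : Fin ℓ → ℝ,
      ∀ x : Fin n → ℝ, x ≠ 0 → ((P.at lam₀).evalAt x).PosDef) :
    (∀ ν : ℕ, SparseSOS.optimalValue P b ≤ SparseSOS.sparseOptimalValue G P b ν) ∧
      Filter.Tendsto (fun ν : ℕ => SparseSOS.sparseOptimalValue G P b ν) Filter.atTop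
        (nhds (SparseSOS.optimalValue P b)) := by
  have hlow : ∀ ν : ℕ, SparseSOS.optimalValue P b ≤ SparseSOS.sparseOptimalValue G P b ν :=
    fun ν => le_iInf fun lam => le_iInf fun S => le_iInf fun hS =>
      iInf₂_le lam (SparseSOS.posSemidef_of_isSparseFeasible hn (hhom lam) hS)
  -- Only the upper half remains: `B*_ν < c` eventually, for each `c > B*`. This form covers `B* =
  -- -∞` and infima that are not attained.
  refine ⟨hlow, tendsto_order.mpr ⟨fun c hc => Filter.Eventually.of_forall fun ν =>
    hc.trans_le (hlow ν), fun c hc => ?_⟩⟩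
  obtain ⟨lam₀, hlam₀⟩ := hstrict
  simp only [SparseSOS.optimalValue, iInf_lt_iff] at hc
  obtain ⟨lam, hlam, hblam⟩ := hc
  obtain ⟨r, hr, hrc⟩ := EReal.lt_iff_exists_real_btwn.mp hblam
  have hr' : b lam < r := EReal.coe_lt_coe_iff.mp hr
  -- The convex upper bound for the cost at the perturbed parameter tends to `b lam < r` as `ε →
  -- 0⁺`; any `ε > 0` already gives strict positivity.
  obtain ⟨ε, hε, hε0, hε1⟩ : ∃ ε : ℝ, (1 - ε) * b lam + ε * b lam₀ < r ∧ 0 < ε ∧ ε < 1 := by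
    have hcont : Continuous fun ε : ℝ => (1 - ε) * b lam + ε * b lam₀ := by fun_prop
    have h1 : ∀ᶠ ε : ℝ in nhdsWithin 0 (Set.Ioi 0), (1 - ε) * b lam + ε * b lam₀ < r :=
      (hcont.tendsto 0).eventually (gt_mem_nhds (by simpa using hr')) |>.filter_mono
        nhdsWithin_le_nhds
    exact (h1.and (Ioo_mem_nhdsGT one_pos)).exists
  set mu : Fin ℓ → ℝ := (1 - ε) • lam + ε • lam₀ with hmu
  have hbmu : b mu < r :=
    (hb.2 (Set.mem_univ lam) (Set.mem_univ lam₀) (by linarith) hε0.le (by ring)).trans_lt hε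
  have hpos : ∀ x : Fin n → ℝ, x ≠ 0 → ((P.at mu).evalAt x).PosDef := by
    intro x hx
    have : (P.at mu).evalAt x = (1 - ε) • (P.at lam).evalAt x + ε • (P.at lam₀).evalAt x := by
      rw [hmu, P.at_convexComb lam lam₀ (by ring)]
      ext i j
      simp [SparseSOS.PolyMatrix.evalAt]
    rw [this]
    exact Matrix.PosDef.posSemidef_add ((hlam x).smul (by linarith)) ((hlam₀ x hx).smul hε0)
  filter_upwards [SparseSOS.eventually_smul_mem_sparseSOS hn hG (P.at mu) (hsymm mu) (hsparse mu)
    (hhom mu) (heven mu) hpos] with ν hν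
  obtain ⟨S, hS⟩ := hν (SparseSOS.degreeBound P ν)
    ((Nat.add_le_add_left (P.degree_at_le mu) _).trans (SparseSOS.le_degreeBound P ν))
  have hle : SparseSOS.sparseOptimalValue G P b ν ≤ (b mu : EReal) :=
    iInf_le_of_le mu (iInf_le_of_le S (iInf_le_of_le hS le_rfl))
  exact hle.trans_lt ((EReal.coe_lt_coe_iff.mpr hbmu).trans hrc)
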